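/- Let $0\le m<d$ be integers. For an integer $n\ge 1$ partition the cube $[0,1]^d$ into the $n^d$ closed small cubes $\prod_{j=1}^d\left[\frac{i_j}{n},\frac{i_j+1}{n}\right]$, $i_j\in\{0,\dots,n-1\}$, and call two small cubes adjacent when they intersect as closed sets. Call a coloring of the small cubes (with any set of colors) admissible if every point belongs to small cubes of at most $m+1$ different colors; in particular, every coloring with $m+1$ colors is admissible. The size of a monochromatic connected component (a connected component of the adjacency graph restricted to the small cubes of one color) is the number of its small cubes. Then: 1. There is a number $f(d,m)>0$, depending only on $d$ and $m$, such that for every $n\ge 1$ every admissible coloring has a monochromatic connected component of size at least $f(d,m)\,n^{d-m}$. 2. If $m\ge 1$, there is a constant $A=A(d,m)\ge 0$ such that for every $n\ge1$ every admissible coloring has a monochromatic connected component of size at least $$\left((m+1)!\binom{d}{m}2^{2m-1}+\frac{A}{n}\right)^{-1}n^{d-m}.$$ 3. For all sufficiently large $n$ (depending on $d$ and $m$), every admissible coloring has a monochromatic connected component of size at least $$\left((m+1)!\binom{d}{m}4^{m}\right)^{-1}n^{d-m}.$$ -/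

import Mathlib

/-- Indices of the `n ^ d` small cubes of the standard partition of `[0,1]^d`. -/
abbrev CubeIndex (d n : ℕ) : Type := Fin d → Fin n

/-- The closed small cube `∏ j, [i j / n, (i j + 1) / n]` with index `i`. -/
def smallCube {d n : ℕ} (i : CubeIndex d n) : Set (Fin d → ℝ) :=
  {x | ∀ j, ((i j : ℕ) : ℝ) / n ≤ x j ∧ x j ≤ (((i j : ℕ) : ℝ) + 1) / n}

/-- The set of colors received by the point `x`: the colors of the closed small cubes
containing `x`. -/
def colorsAt {d n : ℕ} {κ : Type*} (c : CubeIndex d n → κ) (x : Fin d → ℝ) : Set κ :=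
  {k | ∃ i, x ∈ smallCube i ∧ c i = k}

/-- Two different small cubes are joined when they have the same color and intersect as closed
sets. The connected components of this graph are the monochromatic connected components of
the coloring. -/
def monoGraph {d n : ℕ} {κ : Type*} (c : CubeIndex d n → κ) : SimpleGraph (CubeIndex d n) where
  Adj i j := i ≠ j ∧ c i = c j ∧ (smallCube i ∩ smallCube j).Nonempty
  symm := ⟨fun _ _ h => ⟨h.1.symm, h.2.1.symm, by rw [Set.inter_comm]; exact h.2.2⟩⟩
  loopless := ⟨fun _ h => h.1 rfl⟩

/-- A coloring with `m + 1` colors gives at most `m + 1` colors to every point. -/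
theorem colorsAt_encard_le {d n m : ℕ} (c : CubeIndex d n → Fin (m + 1)) (x : Fin d → ℝ) :
    (colorsAt c x).encard ≤ ((m + 1 : ℕ) : ℕ∞) :=
  (Set.encard_le_encard (Set.subset_univ _)).trans (by simp [Set.encard_univ])

/-!
# Large monochromatic components in colorings of the cube

The argument is a discrete form of Gromov's contraction in the space of cycles, carried out with
cubical cochains modulo two on the grid dual to the partition: its vertices are the small cubes, and
its `k`-dimensional cubes are dual to the `(d - k)`-dimensional faces of the partition. The grid is
extended to `Fin d → ℕ` by repeating the last layer of small cubes, and `size n` counts the cubes in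
the box `[0, n - 1]^d` on which a cochain is nonzero.

Sending each small cube to its monochromatic component gives a map `φ` from the vertices of the grid
to a finite set `V`. By admissibility the vertices of a unit cube have at most `m + 1` images, so on
the Kuhn triangulation of the grid `φ` is a simplicial map to a complex of dimension at most `m`. The
pullback of the indicator of a simplex `σ ⊆ V` is a cubical cochain `simplexCochain φ σ` of degree
`σ.card - 1` with
`coboundary (simplexCochain φ σ) = ∑ y ∉ σ, simplexCochain φ (σ ∪ {y})`, and it vanishes if `σ` has
more than `m + 1` elements.

A cocycle `z` of positive degree is the coboundary of a cochain of size at most `n * size n z`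
(`exists_fill`): push in one coordinate direction after the other to a hyperplane which meets few
cubes of `z`. By descending induction on `σ.card`, filling turns `simplexCochain φ σ` into a cocycle
`z σ = simplexCochain φ σ + ∑ y ∉ σ, fill (z (σ ∪ {y}))` (`completedCochain`). For a single vertex
this is a cocycle of degree zero, hence constant. In the sum of `z {x}` over all `x` each filling for
a pair occurs twice, and what remains is the sum of the indicators of the fibers of `φ`, which is `1`.
So some `z {x}` is identically `1` and has size `n ^ d`. On the other hand its size is at most
`∑ k ≤ m, n ^ k * k ! * (the total size of simplexCochain φ τ for τ ∋ x with k + 1 elements)`, and all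
the cubes counted there have a vertex in the component `x`. If `x` consists of `s` small cubes, the
term `k = m` is at most `n ^ m * m ! * (d.choose m * 2 ^ m * s)` because a unit cube carries at most
one simplex with `m + 1` vertices; the other terms are of lower order in `n`. Hence
`n ^ (d - m) ≤ (m ! * d.choose m * 2 ^ m + A / n) * s` (`exists_large_component`), which implies all
three bounds.
-/

/-! ### Cubical cochains modulo two -/

section Cochains

variable {ι : Type*} [DecidableEq ι]

/-- A cubical cochain modulo two on the grid `ι → ℕ`. The value `z S v` is taken on the unit cube
with lowest vertex `v` and set of directions `S`; cochains of all degrees live together, the degree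
of a cube being the cardinality of `S`. -/
abbrev CubeCochain (ι : Type*) : Type _ := Finset ι → (ι → ℕ) → ZMod 2

/-- The cubical coboundary: the sum of `z` over the facets of a cube. -/
def coboundary (z : CubeCochain ι) : CubeCochain ι := fun S v =>
  ∑ i ∈ S, (z (S.erase i) v + z (S.erase i) (v + Pi.single i 1))

/-- The operator dual to moving a cube in the direction `j` to the hyperplane `v j = a`: the cochain
`z` restricted to this hyperplane and extended constantly in the direction `j`. -/
def slice (j : ι) (a : ℕ) (z : CubeCochain ι) : CubeCochain ι := fun S v =>
  if j ∈ S then 0 else z S (Function.update v j a)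

/-- The homotopy between the identity and `slice j a`: the sum of `z` over the cubes swept when
a cube moves in the direction `j` to the hyperplane `v j = a`. Modulo two, the sum over the interval
between `v j` and `a` is the difference of two sums over initial segments, whichever is longer. -/
def sweep (j : ι) (a : ℕ) (z : CubeCochain ι) : CubeCochain ι := fun S v =>
  if j ∈ S then 0 else
    ∑ b ∈ Finset.range (v j), z (insert j S) (Function.update v j b) +
      ∑ b ∈ Finset.range a, z (insert j S) (Function.update v j b)

theorem coboundary_add (z w : CubeCochain ι) :
    coboundary (z + w) = coboundary z + coboundary w := by
  funext S v
  simp only [coboundary, Pi.add_apply, ← Finset.sum_add_distrib]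
  exact Finset.sum_congr rfl fun _ _ => by ring

@[simp] theorem coboundary_zero : coboundary (0 : CubeCochain ι) = 0 := by
  funext S v
  simp [coboundary]

theorem coboundary_sum {β : Type*} (s : Finset β) (z : β → CubeCochain ι) :
    coboundary (∑ b ∈ s, z b) = ∑ b ∈ s, coboundary (z b) :=
  map_sum (AddMonoidHom.mk' (coboundary (ι := ι)) coboundary_add) z s

theorem update_add_single_of_ne {i j : ι} (h : i ≠ j) (v : ι → ℕ) (a : ℕ) :
    Function.update (v + Pi.single i 1) j a = Function.update v j a + Pi.single i 1 := by
  funext k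
  by_cases hk : k = j
  · subst hk
    simp [h.symm]
  · simp [hk]

theorem update_add_single_self (j : ι) (v : ι → ℕ) (a : ℕ) :
    Function.update (v + Pi.single j 1) j a = Function.update v j a := by
  funext k
  by_cases hk : k = j
  · subst hk
    simp
  · simp [hk]

theorem coboundary_slice (j : ι) (a : ℕ) (z : CubeCochain ι) :
    coboundary (slice j a z) = slice j a (coboundary z) := by
  funext S v
  by_cases hj : j ∈ S
  · simp only [slice, hj, if_true, coboundary]
    rw [Finset.sum_eq_single_of_mem j hj]
    · simp [update_add_single_self, CharTwo.add_self_eq_zero]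
    · intro i _ hi
      simp [hj, hi.symm]
  · simp only [slice, hj, if_false, coboundary]
    refine Finset.sum_congr rfl fun i hi => ?_
    have hij : i ≠ j := fun h => hj (h ▸ hi)
    simp [hj, update_add_single_of_ne hij]

/-- Modulo two, the off-diagonal sum of a symmetric function vanishes. -/
theorem sum_sum_erase_eq_zero {β : Type*} [DecidableEq β] (s : Finset β) {g : β → β → ZMod 2}
    (hg : ∀ a b, g a b = g b a) : ∑ a ∈ s, ∑ b ∈ s.erase a, g a b = 0 := by
  rw [Finset.sum_sigma']
  refine Finset.sum_involution (fun p _ => ⟨p.2, p.1⟩) ?_ ?_ ?_ ?_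
  · rintro ⟨a, b⟩ _
    change g a b + g b a = 0
    rw [hg a b, CharTwo.add_self_eq_zero]
  · rintro ⟨a, b⟩ hab _ h
    simp only [Finset.mem_sigma, Finset.mem_erase] at hab
    exact hab.2.1 (congrArg Sigma.fst h)
  · rintro ⟨a, b⟩ hab
    simp only [Finset.mem_sigma, Finset.mem_erase] at hab ⊢
    exact ⟨hab.2.2, hab.2.1.symm, hab.1⟩
  · rintro ⟨a, b⟩ _
    rfl

/-- Modulo two, the values of a sequence at consecutive indices telescope. -/
theorem sum_range_add_succ_charTwo (g : ℕ → ZMod 2) (k : ℕ) :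
    ∑ b ∈ Finset.range k, (g b + g (b + 1)) = g k + g 0 := by
  have := Finset.sum_range_sub g k
  rw [CharTwo.sub_eq_add] at this
  rw [← this]
  exact Finset.sum_congr rfl fun b _ => by rw [CharTwo.sub_eq_add, add_comm]

/-- The homotopy formula for `sweep`, applied to a cocycle. -/
theorem coboundary_sweep (j : ι) (a : ℕ) {z : CubeCochain ι} (hz : coboundary z = 0) :
    coboundary (sweep j a z) = z + slice j a z := by
  funext S v
  by_cases hj : j ∈ S
  · have h1 : coboundary (sweep j a z) S v =
        sweep j a z (S.erase j) v + sweep j a z (S.erase j) (v + Pi.single j 1) := by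
      simp only [coboundary]
      refine Finset.sum_eq_single_of_mem j hj fun i _ hi => ?_
      simp [sweep, hj, hi.symm]
    rw [h1]
    simp only [sweep, slice, hj, Finset.notMem_erase, if_false, if_true, Finset.insert_erase hj,
      Pi.add_apply, Pi.single_eq_same, Finset.sum_range_succ, update_add_single_self,
      Function.update_eq_self]
    generalize ∑ b ∈ Finset.range (v j), z S (Function.update v j b) = p
    generalize ∑ b ∈ Finset.range a, z S (Function.update v j b) = q
    linear_combination (p + q) * (CharTwo.two_eq_zero : (2 : ZMod 2) = 0)
  · -- The cocycle condition on the cube `S ∪ {j}` above `S` at height `b`.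
    have key : ∀ b, ∑ i ∈ S, (z (insert j (S.erase i)) (Function.update v j b) +
        z (insert j (S.erase i)) (Function.update v j b + Pi.single i 1)) =
        z S (Function.update v j b) + z S (Function.update v j (b + 1)) := by
      intro b
      have h := congrFun (congrFun hz (insert j S)) (Function.update v j b)
      simp only [coboundary, Finset.sum_insert hj, Finset.erase_insert hj, Pi.zero_apply] at h
      have hu : Function.update v j b + Pi.single j 1 = Function.update v j (b + 1) := by
        funext k
        by_cases hk : k = j
        · subst hk
          simp
        · simp [hk]
      rw [hu] at h
      rw [← sub_eq_zero, CharTwo.sub_eq_add, add_comm, ← h]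
      congr 1
      refine Finset.sum_congr rfl fun i hi => ?_
      have hij : j ≠ i := fun h => hj (h ▸ hi)
      rw [Finset.erase_insert_of_ne hij]
    have h1 : coboundary (sweep j a z) S v =
        ∑ b ∈ Finset.range (v j), (z S (Function.update v j b) +
          z S (Function.update v j (b + 1))) +
        ∑ b ∈ Finset.range a, (z S (Function.update v j b) +
          z S (Function.update v j (b + 1))) := by
      simp only [← key]
      rw [Finset.sum_comm, Finset.sum_comm (s := Finset.range a), ← Finset.sum_add_distrib]
      simp only [coboundary]
      refine Finset.sum_congr rfl fun i hi => ?_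
      have hij : i ≠ j := fun h => hj (h ▸ hi)
      simp only [sweep, Finset.mem_erase, hj, and_false, if_false, update_add_single_of_ne hij,
        Finset.sum_add_distrib, Pi.add_apply, Pi.single_eq_of_ne hij.symm, add_zero]
      ring
    rw [h1, sum_range_add_succ_charTwo (fun b => z S (Function.update v j b)),
      sum_range_add_succ_charTwo (fun b => z S (Function.update v j b))]
    simp only [slice, hj, if_false, Pi.add_apply, Function.update_eq_self]
    linear_combination z S (Function.update v j 0) * (CharTwo.two_eq_zero : (2 : ZMod 2) = 0)

/-- A cocycle of degree zero is constant, the grid being connected. -/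
theorem apply_empty_eq_of_cocycle [Fintype ι] {z : CubeCochain ι} (hz : coboundary z = 0)
    (v : ι → ℕ) : z ∅ v = z ∅ 0 := by
  have step : ∀ (i : ι) (w : ι → ℕ), z ∅ (w + Pi.single i 1) = z ∅ w := by
    intro i w
    have h := congrFun (congrFun hz {i}) w
    simp only [coboundary, Finset.sum_singleton, Finset.erase_singleton, Pi.zero_apply] at h
    exact (CharTwo.add_eq_zero.mp h).symm
  have line : ∀ (i : ι) (k : ℕ) (w : ι → ℕ), z ∅ (w + Pi.single i k) = z ∅ w := by
    intro i k
    induction k with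
    | zero => simp
    | succ k ih =>
      intro w
      rw [Pi.single_add, ← add_assoc, step, ih]
  have all : ∀ s : Finset ι, z ∅ (∑ i ∈ s, Pi.single i (v i)) = z ∅ 0 := by
    intro s
    induction s using Finset.induction_on with
    | empty => simp
    | insert i s hi ih => rw [Finset.sum_insert hi, add_comm, line, ih]
  simpa [Finset.univ_sum_single] using all Finset.univ

/-! ### Filling cocycles in a box -/

variable [Fintype ι]

/-- The cubes all of whose vertices have coordinates smaller than `n`. -/
def cells (ι : Type*) [DecidableEq ι] [Fintype ι] (n : ℕ) : Finset (Finset ι × (ι → ℕ)) :=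
  (Finset.univ ×ˢ Fintype.piFinset fun _ => Finset.range n).filter
    fun c => ∀ j ∈ c.1, c.2 j + 1 < n

theorem mem_cells {n : ℕ} {c : Finset ι × (ι → ℕ)} :
    c ∈ cells ι n ↔ (∀ j, c.2 j < n) ∧ ∀ j ∈ c.1, c.2 j + 1 < n := by
  simp [cells]

/-- The number of cubes of the box `[0, n - 1] ^ ι` on which a cochain does not vanish. -/
def size (n : ℕ) (z : CubeCochain ι) : ℕ := ((cells ι n).filter fun c => z c.1 c.2 ≠ 0).card

@[simp] theorem size_zero (n : ℕ) : size n (0 : CubeCochain ι) = 0 := by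
  simp [size]

theorem size_add_le (n : ℕ) (z w : CubeCochain ι) : size n (z + w) ≤ size n z + size n w := by
  unfold size
  refine le_trans (Finset.card_le_card ?_) (Finset.card_union_le _ _)
  intro c hc
  simp only [Finset.mem_union, Finset.mem_filter, Pi.add_apply] at hc ⊢
  by_contra h
  push Not at h
  exact hc.2 (by rw [h.1 hc.1, h.2 hc.1, add_zero])

theorem size_sum_le {β : Type*} (n : ℕ) (s : Finset β) (z : β → CubeCochain ι) :
    size n (∑ b ∈ s, z b) ≤ ∑ b ∈ s, size n (z b) :=
  Finset.le_sum_of_subadditive (size n) (size_zero n).le (size_add_le n) s z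

theorem size_sweep_le {n a : ℕ} (ha : a < n) (j : ι) (z : CubeCochain ι) :
    size n (sweep j a z) ≤
      n * ((cells ι n).filter fun c => j ∈ c.1 ∧ z c.1 c.2 ≠ 0).card := by
  have h : size n (sweep j a z) ≤
      (((cells ι n).filter fun c => j ∈ c.1 ∧ z c.1 c.2 ≠ 0) ×ˢ Finset.range n).card := by
    refine Finset.card_le_card_of_surjOn
      (fun p => (p.1.1.erase j, Function.update p.1.2 j p.2)) ?_
    rintro ⟨S, v⟩ hc
    simp only [Finset.coe_filter, Set.mem_ofPred_eq, mem_cells] at hc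
    obtain ⟨⟨hv, hS⟩, hne⟩ := hc
    have hj : j ∉ S := fun hj => hne (by simp [sweep, hj])
    obtain ⟨b, hb, hzb⟩ : ∃ b, b + 1 < n ∧ z (insert j S) (Function.update v j b) ≠ 0 := by
      by_contra hcon
      push Not at hcon
      apply hne
      simp only [sweep, hj, if_false]
      rw [Finset.sum_eq_zero, Finset.sum_eq_zero, add_zero]
      · intro b hb
        rw [Finset.mem_range] at hb
        exact hcon b (by omega)
      · intro b hb
        rw [Finset.mem_range] at hb
        exact hcon b (by have := hv j; omega)
    refine ⟨((insert j S, Function.update v j b), v j), ?_, ?_⟩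
    · simp only [Finset.coe_product, Set.mem_prod, Finset.mem_coe, Finset.mem_filter, mem_cells,
        Finset.mem_range]
      refine ⟨⟨⟨fun i => ?_, fun i hi => ?_⟩, Finset.mem_insert_self _ _, hzb⟩, hv j⟩
      · by_cases hij : i = j
        · subst hij
          simp only [Function.update_self]
          omega
        · simpa [hij] using hv i
      · by_cases hij : i = j
        · subst hij
          simpa using hb
        · simpa [hij] using hS i (Finset.mem_of_mem_insert_of_ne hi hij)
    · simp [Finset.erase_insert hj]
  rwa [Finset.card_product, Finset.card_range, mul_comm] at h

/-- Averaging over the `n` parallel hyperplanes gives one on which `z` is sparse, so that extending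
the restriction of `z` constantly does not increase the size. -/
theorem exists_size_slice_le {n : ℕ} (hn : 0 < n) (j : ι) (z : CubeCochain ι) :
    ∃ a < n, size n (slice j a z) ≤
      ((cells ι n).filter fun c => j ∉ c.1 ∧ z c.1 c.2 ≠ 0).card := by
  set F := (cells ι n).filter fun c => j ∉ c.1 ∧ z c.1 c.2 ≠ 0 with hF
  have hmaps : ∀ c ∈ F, c.2 j ∈ Finset.range n := fun c hc =>
    Finset.mem_range.mpr ((mem_cells.mp (Finset.mem_filter.mp hc).1).1 j)
  obtain ⟨a, ha, hcard⟩ : ∃ a ∈ Finset.range n, n * (F.filter fun c => c.2 j = a).card ≤ F.card := by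
    refine Finset.exists_le_of_sum_le (Finset.nonempty_range_iff.mpr hn.ne') ?_
    rw [← Finset.mul_sum, ← Finset.card_eq_sum_card_fiberwise hmaps]
    simp
  refine ⟨a, Finset.mem_range.mp ha, le_trans ?_ hcard⟩
  have h : size n (slice j a z) ≤ ((F.filter fun c => c.2 j = a) ×ˢ Finset.range n).card := by
    refine Finset.card_le_card_of_surjOn (fun p => (p.1.1, Function.update p.1.2 j p.2)) ?_
    rintro ⟨S, v⟩ hc
    simp only [Finset.coe_filter, Set.mem_ofPred_eq, mem_cells] at hc
    obtain ⟨⟨hv, hS⟩, hne⟩ := hc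
    have hj : j ∉ S := fun hj => hne (by simp [slice, hj])
    simp only [slice, hj, if_false] at hne
    refine ⟨((S, Function.update v j a), v j), ?_, by simp⟩
    simp only [Finset.coe_product, Set.mem_prod, Finset.mem_coe, Finset.mem_filter, mem_cells,
      Finset.mem_range, hF]
    refine ⟨⟨⟨⟨fun i => ?_, fun i hi => ?_⟩, hj, hne⟩, by simp⟩, hv j⟩
    · by_cases hij : i = j
      · subst hij
        simpa using ha
      · simpa [hij] using hv i
    · have hij : i ≠ j := fun h => hj (h ▸ hi)
      simpa [hij] using hS i hi
  rwa [Finset.card_product, Finset.card_range, mul_comm] at h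

/-- The linear isoperimetric inequality in the box, by induction on the set `D` of directions in
which the cocycle still extends. -/
theorem exists_fill_of_subset {n : ℕ} (hn : 0 < n) (k : ℕ) (D : Finset ι) :
    ∀ z : CubeCochain ι, coboundary z = 0 → (∀ S v, z S v ≠ 0 → S.card = k + 1 ∧ S ⊆ D) →
      ∃ f : CubeCochain ι, coboundary f = z ∧ (∀ S v, f S v ≠ 0 → S.card = k) ∧
        size n f ≤ n * size n z := by
  induction D using Finset.induction_on with
  | empty =>
    intro z _ hS
    have hz0 : z = 0 := by
      funext S v
      by_contra h
      obtain ⟨h1, h2⟩ := hS S v h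
      rw [Finset.subset_empty.mp h2] at h1
      simp at h1
    exact ⟨0, by simp [hz0], by simp, by simp⟩
  | insert j D hj ih =>
    intro z hz hS
    obtain ⟨a, ha, hslice⟩ := exists_size_slice_le hn j z
    obtain ⟨g, hg, hgk, hgn⟩ := ih (slice j a z) (by
      rw [coboundary_slice, hz]
      funext S v
      simp [slice]) (by
      intro S v h
      have hjS : j ∉ S := fun hjS => h (by simp [slice, hjS])
      simp only [slice, hjS, if_false] at h
      obtain ⟨h1, h2⟩ := hS _ _ h
      exact ⟨h1, (Finset.subset_insert_iff_of_notMem hjS).mp h2⟩)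
    refine ⟨sweep j a z + g, ?_, ?_, ?_⟩
    · rw [coboundary_add, coboundary_sweep j a hz, hg, add_assoc]
      funext S v
      simp [CharTwo.add_self_eq_zero]
    · intro S v h
      by_cases hg0 : g S v = 0
      · have hjS : j ∉ S := fun hjS => h (by simp [sweep, hjS, hg0])
        simp only [Pi.add_apply, hg0, add_zero, sweep, hjS, if_false] at h
        by_contra hcard
        have hzero : ∀ w, z (insert j S) w = 0 := by
          intro w
          by_contra hw
          have := (hS _ _ hw).1
          rw [Finset.card_insert_of_notMem hjS] at this
          omega
        exact h (by simp [hzero])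
      · exact hgk S v hg0
    · have hsplit : ((cells ι n).filter fun c => j ∈ c.1 ∧ z c.1 c.2 ≠ 0).card +
          ((cells ι n).filter fun c => j ∉ c.1 ∧ z c.1 c.2 ≠ 0).card = size n z := by
        have h := Finset.card_filter_add_card_filter_not
          (s := (cells ι n).filter fun c => z c.1 c.2 ≠ 0) (fun c => j ∈ c.1)
        simp only [Finset.filter_filter] at h
        simpa only [size, and_comm] using h
      calc size n (sweep j a z + g) ≤ size n (sweep j a z) + size n g := size_add_le _ _ _
        _ ≤ n * ((cells ι n).filter fun c => j ∈ c.1 ∧ z c.1 c.2 ≠ 0).card +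
            n * ((cells ι n).filter fun c => j ∉ c.1 ∧ z c.1 c.2 ≠ 0).card :=
          add_le_add (size_sweep_le ha j z) (hgn.trans (Nat.mul_le_mul_left _ hslice))
        _ = n * size n z := by rw [← mul_add, hsplit]

/-- A choice of fillings with the isoperimetric inequality, for cocycles of all positive degrees. -/
theorem exists_fill {n : ℕ} (hn : 0 < n) : ∃ fill : CubeCochain ι → CubeCochain ι,
    ∀ (k : ℕ) (z : CubeCochain ι), coboundary z = 0 → (∀ S v, z S v ≠ 0 → S.card = k + 1) →
      coboundary (fill z) = z ∧ (∀ S v, fill z S v ≠ 0 → S.card = k) ∧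
        size n (fill z) ≤ n * size n z := by
  have h : ∀ z : CubeCochain ι, ∃ f : CubeCochain ι, ∀ k : ℕ, coboundary z = 0 →
      (∀ S v, z S v ≠ 0 → S.card = k + 1) →
      coboundary f = z ∧ (∀ S v, f S v ≠ 0 → S.card = k) ∧ size n f ≤ n * size n z := by
    intro z
    by_cases hz0 : z = 0
    · exact ⟨0, fun k _ _ => by simp [hz0]⟩
    by_cases hk : ∃ k, coboundary z = 0 ∧ ∀ S v, z S v ≠ 0 → S.card = k + 1
    · obtain ⟨k, hz, hS⟩ := hk
      obtain ⟨f, hf⟩ := exists_fill_of_subset hn k Finset.univ z hz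
        fun S v h => ⟨hS S v h, Finset.subset_univ _⟩
      refine ⟨f, fun k' _ hS' => ?_⟩
      -- A nonzero cochain has at most one degree.
      obtain ⟨S, v, hSv⟩ : ∃ S v, z S v ≠ 0 := by
        by_contra hcon
        push Not at hcon
        exact hz0 (funext fun S => funext fun v => hcon S v)
      have : k' = k := by
        have h1 := hS S v hSv
        have h2 := hS' S v hSv
        omega
      rw [this]
      exact hf
    · exact ⟨0, fun k h1 h2 => absurd ⟨k, h1, h2⟩ hk⟩
  choose fill hfill using h
  exact ⟨fill, fun k z => hfill z k⟩

end Cochains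

/-! ### Pulling simplicial cochains back to cubes -/

section Pullback

variable {ι V : Type*} [DecidableEq ι] [DecidableEq V]

/-- The simplicial coboundary modulo two, on cochains of the full simplex with vertex set `V`. It is
augmented: the empty simplex counts. -/
def simplexCoboundary (α : Finset V → ZMod 2) : Finset V → ZMod 2 := fun τ =>
  ∑ x ∈ τ, α (τ.erase x)

/-- The cochain dual to the cone with apex `x`. Degenerate cones count as zero. -/
def coneDual (x : V) (α : Finset V → ZMod 2) : Finset V → ZMod 2 := fun τ =>
  if x ∈ τ then 0 else α (insert x τ)

/-- The pullback of a simplicial `k`-cochain along a vertex map `φ`: on a `k`-cube it is the sum over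
the monotone edge paths from the lowest to the highest vertex, that is, over the simplices of the
Kuhn triangulation of the cube, of the value at the image simplex; degenerate images count as zero.
The recursion splits a path at its first edge. On cubes of other dimensions the value is zero. -/
def pullback (φ : (ι → ℕ) → V) : ℕ → (Finset V → ZMod 2) → CubeCochain ι
  | 0, α => fun S v => if S = ∅ then α {φ v} else 0
  | k + 1, α => fun S v =>
    ∑ i ∈ S, pullback φ k (coneDual (φ v) α) (S.erase i) (v + Pi.single i 1)

/-- A cone is a homotopy between the identity and zero on the augmented cochains of a simplex. -/
theorem coneDual_simplexCoboundary (x : V) (α : Finset V → ZMod 2) :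
    coneDual x (simplexCoboundary α) = α + simplexCoboundary (coneDual x α) := by
  funext τ
  by_cases hx : x ∈ τ
  · have h : simplexCoboundary (coneDual x α) τ = α τ := by
      simp only [simplexCoboundary]
      rw [Finset.sum_eq_single_of_mem x hx]
      · simp [coneDual, Finset.insert_erase hx]
      · intro y _ hy
        simp [coneDual, hx, hy.symm]
    simp [coneDual, hx, h, CharTwo.add_self_eq_zero]
  · simp only [coneDual, hx, if_false, simplexCoboundary, Finset.sum_insert hx,
      Finset.erase_insert hx, Pi.add_apply]
    congr 1
    refine Finset.sum_congr rfl fun y hy => ?_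
    have hxy : x ≠ y := fun h => hx (h ▸ hy)
    rw [if_neg (by simp [hx]), Finset.erase_insert_of_ne hxy]

theorem coneDual_add (x : V) (α β : Finset V → ZMod 2) :
    coneDual x (α + β) = coneDual x α + coneDual x β := by
  funext τ
  by_cases hx : x ∈ τ <;> simp [coneDual, hx]

theorem pullback_add (φ : (ι → ℕ) → V) (k : ℕ) (α β : Finset V → ZMod 2) :
    pullback φ k (α + β) = pullback φ k α + pullback φ k β := by
  induction k generalizing α β with
  | zero =>
    funext S v
    by_cases hS : S = ∅ <;> simp [pullback, hS]
  | succ k ih =>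
    funext S v
    simp [pullback, coneDual_add, ih, Finset.sum_add_distrib]

theorem pullback_sum {β : Type*} (φ : (ι → ℕ) → V) (k : ℕ) (s : Finset β)
    (α : β → Finset V → ZMod 2) :
    pullback φ k (∑ b ∈ s, α b) = ∑ b ∈ s, pullback φ k (α b) :=
  map_sum (AddMonoidHom.mk' (pullback φ k) (pullback_add φ k)) α s

/-- The pullback is a cochain map: the faces interior to the Kuhn triangulation of a cube cancel. -/
theorem coboundary_pullback (φ : (ι → ℕ) → V) (k : ℕ) (α : Finset V → ZMod 2) :
    coboundary (pullback φ k α) = pullback φ (k + 1) (simplexCoboundary α) := by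
  induction k generalizing α with
  | zero =>
    funext S v
    simp only [coboundary, pullback]
    refine Finset.sum_congr rfl fun i _ => ?_
    by_cases hS : S.erase i = ∅
    · simp only [hS, if_true, coneDual_simplexCoboundary, Pi.add_apply]
      simp [simplexCoboundary, coneDual, add_comm]
    · simp [hS]
  | succ k ih =>
    funext S v
    have hswap : ∑ i ∈ S, ∑ j ∈ S.erase i, pullback φ k (coneDual (φ v) α)
          ((S.erase i).erase j) (v + Pi.single j 1) =
        ∑ i ∈ S, ∑ j ∈ S.erase i, pullback φ k (coneDual (φ v) α)
          ((S.erase i).erase j) (v + Pi.single i 1) := by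
      rw [Finset.sum_comm' (t' := S) (s' := fun j => S.erase j)
        (fun i j => by simp only [Finset.mem_erase]; tauto)]
      refine Finset.sum_congr rfl fun i _ => Finset.sum_congr rfl fun j _ => ?_
      rw [Finset.erase_right_comm]
    have hcancel : ∑ i ∈ S, ∑ j ∈ S.erase i, pullback φ k (coneDual (φ v) α)
        ((S.erase i).erase j) (v + Pi.single i 1 + Pi.single j 1) = 0 := by
      refine sum_sum_erase_eq_zero S fun i j => ?_
      rw [Finset.erase_right_comm, add_right_comm]
    have hR : ∀ i, pullback φ (k + 1) (coneDual (φ v) (simplexCoboundary α)) (S.erase i)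
          (v + Pi.single i 1) = pullback φ (k + 1) α (S.erase i) (v + Pi.single i 1) +
        (∑ j ∈ S.erase i, pullback φ k (coneDual (φ v) α)
          ((S.erase i).erase j) (v + Pi.single i 1) +
        ∑ j ∈ S.erase i, pullback φ k (coneDual (φ v) α)
          ((S.erase i).erase j) (v + Pi.single i 1 + Pi.single j 1)) := by
      intro i
      rw [coneDual_simplexCoboundary, pullback_add, ← ih]
      simp only [Pi.add_apply, coboundary, Finset.sum_add_distrib]
    have hL : coboundary (pullback φ (k + 1) α) S v =
        ∑ i ∈ S, ∑ j ∈ S.erase i, pullback φ k (coneDual (φ v) α)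
          ((S.erase i).erase j) (v + Pi.single j 1) +
        ∑ i ∈ S, pullback φ (k + 1) α (S.erase i) (v + Pi.single i 1) := by
      simp only [coboundary, Finset.sum_add_distrib]
      rfl
    have hRR : pullback φ (k + 1 + 1) (simplexCoboundary α) S v =
        ∑ i ∈ S, pullback φ (k + 1) (coneDual (φ v) (simplexCoboundary α)) (S.erase i)
          (v + Pi.single i 1) := rfl
    rw [hL, hRR, Finset.sum_congr rfl fun i _ => hR i, Finset.sum_add_distrib,
      Finset.sum_add_distrib, hcancel, hswap, add_zero, add_comm]

/-- The highest vertex of the cube with lowest vertex `v` and directions `S`. -/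
def topVertex (S : Finset ι) (v : ι → ℕ) : ι → ℕ := fun j => v j + if j ∈ S then 1 else 0

theorem pullback_card {φ : (ι → ℕ) → V} {k : ℕ} {α : Finset V → ZMod 2} {S : Finset ι}
    {v : ι → ℕ} (h : pullback φ k α S v ≠ 0) : S.card = k := by
  induction k generalizing α S v with
  | zero =>
    by_contra hS
    rw [Finset.card_eq_zero] at hS
    exact h (by simp [pullback, hS])
  | succ k ih =>
    obtain ⟨i, hi, hne⟩ := Finset.exists_ne_zero_of_sum_ne_zero h
    rw [← ih hne, Finset.card_erase_add_one hi]

theorem exists_of_pullback_ne_zero [Fintype ι] {φ : (ι → ℕ) → V} {k : ℕ}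
    {α : Finset V → ZMod 2} {S : Finset ι} {v : ι → ℕ} (h : pullback φ k α S v ≠ 0) :
    ∃ τ, α τ ≠ 0 ∧ τ ⊆ (Finset.Icc v (topVertex S v)).image φ := by
  induction k generalizing α S v with
  | zero =>
    by_cases hS : S = ∅
    · refine ⟨{φ v}, by simpa [pullback, hS] using h, ?_⟩
      rw [Finset.singleton_subset_iff]
      exact Finset.mem_image_of_mem _ (Finset.left_mem_Icc.mpr fun j => Nat.le_add_right _ _)
    · exact absurd (by simp [pullback, hS]) h
  | succ k ih =>
    obtain ⟨i, hi, hne⟩ := Finset.exists_ne_zero_of_sum_ne_zero h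
    obtain ⟨τ, hτ, hsub⟩ := ih hne
    have hx : φ v ∉ τ := fun hx => hτ (by simp [coneDual, hx])
    refine ⟨insert (φ v) τ, by simpa [coneDual, hx] using hτ, Finset.insert_subset
      (Finset.mem_image_of_mem _ (Finset.left_mem_Icc.mpr fun j => Nat.le_add_right _ _))
      (hsub.trans (Finset.image_subset_image (Finset.Icc_subset_Icc ?_ ?_)))⟩
    · exact le_self_add
    · intro j
      by_cases hj : j = i
      · subst hj
        simp [topVertex, hi]
      · simp [topVertex, hj]

/-- In the simplex on `V` the coboundary of the indicator of a face is the sum of the indicators of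
its cofaces. -/
theorem simplexCoboundary_single [Fintype V] (σ : Finset V) :
    simplexCoboundary (Pi.single σ 1) = ∑ y ∈ σᶜ, Pi.single (insert y σ) (1 : ZMod 2) := by
  funext τ
  simp only [simplexCoboundary, Finset.sum_apply, Pi.single_apply]
  rw [← Finset.sum_filter, ← Finset.sum_filter]
  congr 1
  ext x
  simp only [Finset.mem_filter, Finset.mem_compl]
  constructor
  · rintro ⟨hx, rfl⟩
    exact ⟨Finset.notMem_erase _ _, (Finset.insert_erase hx).symm⟩
  · rintro ⟨hx, rfl⟩
    exact ⟨Finset.mem_insert_self _ _, Finset.erase_insert hx⟩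

/-- The cochain of the simplex `σ`: the cubes which `φ` maps onto `σ`, counted modulo two by
the simplices of the Kuhn triangulation. It is dual to the intersection of the sets
`φ ⁻¹' {x}` for `x ∈ σ`. -/
def simplexCochain (φ : (ι → ℕ) → V) (σ : Finset V) : CubeCochain ι :=
  pullback φ (σ.card - 1) (Pi.single σ 1)

theorem coboundary_simplexCochain [Fintype V] (φ : (ι → ℕ) → V) {σ : Finset V}
    (hσ : σ.Nonempty) :
    coboundary (simplexCochain φ σ) = ∑ y ∈ σᶜ, simplexCochain φ (insert y σ) := by
  rw [simplexCochain, coboundary_pullback, simplexCoboundary_single, pullback_sum]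
  refine Finset.sum_congr rfl fun y hy => ?_
  rw [simplexCochain, Finset.card_insert_of_notMem (Finset.mem_compl.mp hy)]
  have := hσ.card_pos
  congr 1
  omega

theorem simplexCochain_card {φ : (ι → ℕ) → V} {σ : Finset V} (hσ : σ.Nonempty) {S : Finset ι}
    {v : ι → ℕ} (h : simplexCochain φ σ S v ≠ 0) : S.card + 1 = σ.card := by
  have := pullback_card h
  have := hσ.card_pos
  omega

theorem subset_of_simplexCochain_ne_zero [Fintype ι] {φ : (ι → ℕ) → V} {σ : Finset V}
    {S : Finset ι} {v : ι → ℕ} (h : simplexCochain φ σ S v ≠ 0) :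
    σ ⊆ (Finset.Icc v (topVertex S v)).image φ := by
  obtain ⟨τ, hτ, hsub⟩ := exists_of_pullback_ne_zero h
  have : τ = σ := by
    by_contra hne
    exact hτ (by simp [hne])
  exact this ▸ hsub

theorem simplexCochain_eq_zero [Fintype ι] {φ : (ι → ℕ) → V} {m : ℕ}
    (hφ : ∀ v, ((Finset.Icc v (topVertex Finset.univ v)).image φ).card ≤ m + 1) {σ : Finset V}
    (hσ : m + 1 < σ.card) : simplexCochain φ σ = 0 := by
  funext S v
  by_contra h
  have h1 := Finset.card_le_card (subset_of_simplexCochain_ne_zero h)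
  have h2 : (Finset.Icc v (topVertex S v)).image φ ⊆
      (Finset.Icc v (topVertex Finset.univ v)).image φ := by
    refine Finset.image_subset_image (Finset.Icc_subset_Icc_right fun j => ?_)
    by_cases hj : j ∈ S <;> simp [topVertex, hj]
  have h3 := (Finset.card_le_card h2).trans (hφ v)
  omega

end Pullback

/-! ### Counting cubes near a set of vertices -/

/-- A cube is determined by its directions, one of its vertices and the position of this vertex. -/
theorem card_cells_meeting_le {ι : Type*} [DecidableEq ι] [Fintype ι] (n k : ℕ)
    (p : (ι → ℕ) → Prop) [DecidablePred p] :
    ((cells ι n).filter fun c : Finset ι × (ι → ℕ) => c.1.card = k ∧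
        ∃ w ∈ Finset.Icc c.2 (topVertex c.1 c.2), p w).card ≤
      (Fintype.card ι).choose k * 2 ^ k *
        ((Fintype.piFinset fun _ : ι => Finset.range n).filter p).card := by
  have hcard : ((Finset.powersetCard k (Finset.univ : Finset ι)).sigma Finset.powerset).card =
      (Fintype.card ι).choose k * 2 ^ k := by
    rw [Finset.card_sigma, Finset.sum_congr rfl fun S hS => by
      rw [Finset.card_powerset, (Finset.mem_powersetCard.mp hS).2], Finset.sum_const,
      Finset.card_powersetCard, smul_eq_mul, Finset.card_univ]
  rw [← hcard, ← Finset.card_product]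
  refine Finset.card_le_card_of_surjOn
    (fun q : ((_ : Finset ι) × Finset ι) × (ι → ℕ) =>
      (q.1.1, fun j => q.2 j - if j ∈ q.1.2 then 1 else 0)) ?_
  rintro ⟨S, v⟩ hc
  simp only [Finset.coe_filter, Set.mem_ofPred_eq, mem_cells, Finset.mem_Icc] at hc
  obtain ⟨⟨hv, hS⟩, hk, w, ⟨hvw, hwt⟩, hw⟩ := hc
  have hw' : ∀ j, w j = v j ∨ j ∈ S ∧ w j = v j + 1 := by
    intro j
    have h1 : v j ≤ w j := hvw j
    have h2 : w j ≤ topVertex S v j := hwt j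
    by_cases hj : j ∈ S <;> simp only [topVertex, hj, if_true, if_false] at h2
    · rcases Nat.lt_or_ge (v j) (w j) with h | h
      · exact Or.inr ⟨hj, by omega⟩
      · exact Or.inl (by omega)
    · exact Or.inl (by omega)
  refine ⟨(⟨S, S.filter fun j => w j ≠ v j⟩, w), ?_, ?_⟩
  · simp only [Finset.coe_product, Set.mem_prod, Finset.mem_coe, Finset.mem_sigma,
      Finset.mem_powersetCard, Finset.mem_powerset, Finset.mem_filter, Fintype.mem_piFinset,
      Finset.mem_range]
    refine ⟨⟨⟨Finset.subset_univ _, hk⟩, Finset.filter_subset _ _⟩, fun j => ?_, hw⟩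
    rcases hw' j with h | ⟨hj, h⟩
    · rw [h]
      exact hv j
    · rw [h]
      exact hS j hj
  · refine Prod.ext rfl (funext fun j => ?_)
    rcases hw' j with h | ⟨hj, h⟩
    · simp [h]
    · simp [h, hj]

/-! ### The cocycles of the vertices of the nerve -/

section Nerve

variable {ι V : Type*} [DecidableEq ι] [Fintype ι] [DecidableEq V] [Fintype V]

/-- The cochain of the simplex `σ` completed to a cocycle by filling, in `r` rounds, the completed
cochains of the cofaces of `σ`. With `r = 0` the cochain is taken to be zero, which is the right
value once `σ` has more vertices than the dimension of the nerve allows. -/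
def completedCochain (fill : CubeCochain ι → CubeCochain ι) (φ : (ι → ℕ) → V) :
    ℕ → Finset V → CubeCochain ι
  | 0, _ => 0
  | r + 1, σ =>
    simplexCochain φ σ + ∑ y ∈ σᶜ, fill (completedCochain fill φ r (insert y σ))

variable {n m : ℕ} {fill : CubeCochain ι → CubeCochain ι} {φ : (ι → ℕ) → V}

theorem completedCochain_cocycle
    (hfill : ∀ (k : ℕ) (z : CubeCochain ι), coboundary z = 0 →
      (∀ S v, z S v ≠ 0 → S.card = k + 1) →
      coboundary (fill z) = z ∧ (∀ S v, fill z S v ≠ 0 → S.card = k) ∧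
        size n (fill z) ≤ n * size n z)
    (hφ : ∀ v, ((Finset.Icc v (topVertex Finset.univ v)).image φ).card ≤ m + 1)
    (r : ℕ) (σ : Finset V) (hσ : σ.Nonempty) (hr : σ.card + r = m + 2) :
    coboundary (completedCochain fill φ r σ) = 0 ∧
      ∀ S v, completedCochain fill φ r σ S v ≠ 0 → S.card + 1 = σ.card := by
  induction r generalizing σ with
  | zero => simp [completedCochain]
  | succ r ih =>
    have hpos := hσ.card_pos
    have hf : ∀ y ∈ σᶜ, _ := fun y hy => by
      have hcard := Finset.card_insert_of_notMem (Finset.mem_compl.mp hy)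
      have h := ih (insert y σ) (Finset.insert_nonempty _ _) (by omega)
      exact hfill (σ.card - 1) _ h.1 fun S v hne => by
        have := h.2 S v hne
        omega
    constructor
    · rw [completedCochain, coboundary_add, coboundary_simplexCochain φ hσ, coboundary_sum,
        Finset.sum_congr rfl fun y hy => (hf y hy).1, ← Finset.sum_add_distrib]
      cases r with
      | zero =>
        refine Finset.sum_eq_zero fun y hy => ?_
        rw [completedCochain, add_zero]
        apply simplexCochain_eq_zero hφ
        rw [Finset.card_insert_of_notMem (Finset.mem_compl.mp hy)]
        omega
      | succ r =>
        funext S v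
        have h2 : ∀ a b : ZMod 2, a + (a + b) = b := fun a b => by
          rw [← add_assoc, CharTwo.add_self_eq_zero, zero_add]
        simp only [completedCochain, Finset.sum_apply, Pi.add_apply, h2, Finset.compl_insert,
          Pi.zero_apply]
        exact sum_sum_erase_eq_zero σᶜ fun y y' => by rw [Finset.insert_comm]
    · intro S v hne
      by_cases h0 : simplexCochain φ σ S v = 0
      · simp only [completedCochain, Pi.add_apply, h0, zero_add, Finset.sum_apply] at hne
        obtain ⟨y, hy, hy0⟩ := Finset.exists_ne_zero_of_sum_ne_zero hne
        have := (hf y hy).2.1 S v hy0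
        omega
      · exact simplexCochain_card hσ h0

/-- Each `τ ⊇ σ` with `k + 1` further elements arises from `k + 1` one-element extensions of `σ`. -/
theorem sum_insert_superset (σ : Finset V) (k : ℕ) (g : Finset V → ℕ) :
    ∑ y ∈ σᶜ, ∑ τ with insert y σ ⊆ τ ∧ τ.card = (insert y σ).card + k, g τ =
      (k + 1) * ∑ τ with σ ⊆ τ ∧ τ.card = σ.card + (k + 1), g τ := by
  rw [Finset.sum_comm' (t' := Finset.univ.filter fun τ => σ ⊆ τ ∧ τ.card = σ.card + (k + 1))
    (s' := fun τ => τ \ σ), Finset.mul_sum]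
  · refine Finset.sum_congr rfl fun τ hτ => ?_
    obtain ⟨h1, h2⟩ := (Finset.mem_filter.mp hτ).2
    rw [Finset.sum_const, Finset.card_sdiff_of_subset h1, h2, smul_eq_mul]
    congr 1
    omega
  · intro y τ
    simp only [Finset.mem_compl, Finset.mem_filter, Finset.mem_univ, true_and, Finset.mem_sdiff,
      Finset.insert_subset_iff]
    constructor
    · rintro ⟨hy, ⟨hyτ, hστ⟩, hc⟩
      rw [Finset.card_insert_of_notMem hy] at hc
      exact ⟨⟨hyτ, hy⟩, hστ, by omega⟩
    · rintro ⟨⟨hyτ, hy⟩, hστ, hc⟩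
      rw [Finset.card_insert_of_notMem hy]
      exact ⟨hy, ⟨hyτ, hστ⟩, by omega⟩

/-- Each filling costs a factor `n`, and the factor `k !` counts the flags from `σ` to `τ`. -/
theorem size_completedCochain_le
    (hfill : ∀ (k : ℕ) (z : CubeCochain ι), coboundary z = 0 →
      (∀ S v, z S v ≠ 0 → S.card = k + 1) →
      coboundary (fill z) = z ∧ (∀ S v, fill z S v ≠ 0 → S.card = k) ∧
        size n (fill z) ≤ n * size n z)
    (hφ : ∀ v, ((Finset.Icc v (topVertex Finset.univ v)).image φ).card ≤ m + 1)
    (r : ℕ) (σ : Finset V) (hσ : σ.Nonempty) (hr : σ.card + r = m + 2) :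
    size n (completedCochain fill φ r σ) ≤ ∑ k ∈ Finset.range r, n ^ k * k.factorial *
      ∑ τ with σ ⊆ τ ∧ τ.card = σ.card + k, size n (simplexCochain φ τ) := by
  induction r generalizing σ with
  | zero => simp [completedCochain]
  | succ r ih =>
    have hpos := hσ.card_pos
    have hy : ∀ y ∈ σᶜ, size n (fill (completedCochain fill φ r (insert y σ))) ≤
        n * ∑ k ∈ Finset.range r, n ^ k * k.factorial *
          ∑ τ with insert y σ ⊆ τ ∧ τ.card = (insert y σ).card + k,
            size n (simplexCochain φ τ) := by
      intro y hy
      have hcard := Finset.card_insert_of_notMem (Finset.mem_compl.mp hy)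
      have h := completedCochain_cocycle hfill hφ r (insert y σ) (Finset.insert_nonempty _ _)
        (by omega)
      refine (hfill (σ.card - 1) _ h.1 fun S v hne => ?_).2.2.trans
        (Nat.mul_le_mul_left _ (ih _ (Finset.insert_nonempty _ _) (by omega)))
      have := h.2 S v hne
      omega
    calc size n (completedCochain fill φ (r + 1) σ)
        ≤ size n (simplexCochain φ σ) +
          ∑ y ∈ σᶜ, size n (fill (completedCochain fill φ r (insert y σ))) :=
          (size_add_le _ _ _).trans (Nat.add_le_add_left (size_sum_le _ _ _) _)
      _ ≤ size n (simplexCochain φ σ) +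
          ∑ y ∈ σᶜ, n * ∑ k ∈ Finset.range r, n ^ k * k.factorial *
            ∑ τ with insert y σ ⊆ τ ∧ τ.card = (insert y σ).card + k,
              size n (simplexCochain φ τ) :=
          Nat.add_le_add_left (Finset.sum_le_sum hy) _
      _ = size n (simplexCochain φ σ) +
          ∑ k ∈ Finset.range r, n ^ (k + 1) * (k + 1).factorial *
            ∑ τ with σ ⊆ τ ∧ τ.card = σ.card + (k + 1), size n (simplexCochain φ τ) := by
          rw [← Finset.mul_sum, Finset.sum_comm, Finset.mul_sum]
          congr 1
          refine Finset.sum_congr rfl fun k _ => ?_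
          rw [← Finset.mul_sum, sum_insert_superset, Nat.factorial_succ]
          ring
      _ ≤ _ := by
          rw [Finset.sum_range_succ', add_comm]
          refine Nat.add_le_add_left ?_ _
          rw [pow_zero, Nat.factorial_zero, one_mul, one_mul]
          exact Finset.single_le_sum (f := fun τ => size n (simplexCochain φ τ))
            (fun _ _ => Nat.zero_le _) (by simp)

/-- A cube has vertices in at most `m + 1` classes, hence carries at most `(m + 1).choose (k + 1)`
simplices with `k + 1` vertices; for `k = m` there is only one. -/
theorem sum_size_simplexCochain_le
    (hφ : ∀ v, ((Finset.Icc v (topVertex Finset.univ v)).image φ).card ≤ m + 1)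
    (n k : ℕ) (x : V) :
    ∑ τ with {x} ⊆ τ ∧ τ.card = ({x} : Finset V).card + k, size n (simplexCochain φ τ) ≤
      (m + 1).choose (k + 1) * ((Fintype.card ι).choose k * 2 ^ k *
        ((Fintype.piFinset fun _ : ι => Finset.range n).filter fun w => φ w = x).card) := by
  refine le_trans ?_ (Nat.mul_le_mul_left _ (card_cells_meeting_le n k fun w => φ w = x))
  simp only [size, Finset.card_filter _ (cells ι n)]
  rw [Finset.sum_comm, Finset.mul_sum]
  refine Finset.sum_le_sum fun c _ => ?_
  rw [← Finset.card_filter, Finset.filter_filter]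
  have hmem : ∀ τ ∈ Finset.univ.filter fun τ => ({x} ⊆ τ ∧ τ.card = ({x} : Finset V).card + k) ∧
      simplexCochain φ τ c.1 c.2 ≠ 0,
      (c.1.card = k ∧ ∃ w ∈ Finset.Icc c.2 (topVertex c.1 c.2), φ w = x) ∧
      τ ∈ Finset.powersetCard (k + 1)
        ((Finset.Icc c.2 (topVertex Finset.univ c.2)).image φ) := by
    intro τ hτ
    obtain ⟨⟨hx, hcard⟩, hne⟩ := (Finset.mem_filter.mp hτ).2
    rw [Finset.singleton_subset_iff] at hx
    rw [Finset.card_singleton] at hcard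
    have hsub := subset_of_simplexCochain_ne_zero hne
    have hS := simplexCochain_card ⟨x, hx⟩ hne
    refine ⟨⟨by omega, by simpa using hsub hx⟩, Finset.mem_powersetCard.mpr ⟨hsub.trans ?_,
      by omega⟩⟩
    refine Finset.image_subset_image (Finset.Icc_subset_Icc_right fun j => ?_)
    by_cases hj : j ∈ c.1 <;> simp [topVertex, hj]
  by_cases hc : c.1.card = k ∧ ∃ w ∈ Finset.Icc c.2 (topVertex c.1 c.2), φ w = x
  · rw [if_pos hc, mul_one]
    refine (Finset.card_le_card fun τ hτ => (hmem τ hτ).2).trans ?_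
    rw [Finset.card_powersetCard]
    exact Nat.choose_le_choose _ (hφ _)
  · rw [if_neg hc, mul_zero, Nat.le_zero, Finset.card_eq_zero]
    exact Finset.eq_empty_of_forall_notMem fun τ hτ => hc (hmem τ hτ).1

/-- The combinatorial core: if every unit cube of the grid has vertices in at most `m + 1` classes
of `φ`, then some class has many vertices in the box `[0, n - 1] ^ ι`. -/
theorem exists_large_fiber (hn : 0 < n)
    (hφ : ∀ v, ((Finset.Icc v (topVertex Finset.univ v)).image φ).card ≤ m + 1) :
    ∃ x : V, n ^ Fintype.card ι ≤ ∑ k ∈ Finset.range (m + 1), n ^ k * k.factorial *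
      ((m + 1).choose (k + 1) * ((Fintype.card ι).choose k * 2 ^ k *
        ((Fintype.piFinset fun _ : ι => Finset.range n).filter fun w => φ w = x).card)) := by
  obtain ⟨fill, hfill⟩ := exists_fill (ι := ι) hn
  -- The fillings cancel in pairs, and the classes partition the vertices.
  have hsum : ∑ x : V, completedCochain fill φ (m + 1) {x} ∅ 0 = 1 := by
    simp only [completedCochain, Pi.add_apply, Finset.sum_apply, Finset.sum_add_distrib]
    have h1 : ∑ x : V, simplexCochain φ {x} ∅ 0 = 1 := by
      simp [simplexCochain, pullback, Pi.single_apply]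
    have h2 : ∑ x : V, ∑ y ∈ ({x} : Finset V)ᶜ,
        fill (completedCochain fill φ m (insert y {x})) ∅ 0 = 0 := by
      simp only [Finset.compl_singleton]
      exact sum_sum_erase_eq_zero Finset.univ fun x y => by rw [Finset.pair_comm]
    rw [h1, h2, add_zero]
  obtain ⟨x, -, hx⟩ := Finset.exists_ne_zero_of_sum_ne_zero (hsum.trans_ne one_ne_zero)
  refine ⟨x, ?_⟩
  have hcard : ({x} : Finset V).card + (m + 1) = m + 2 := by
    rw [Finset.card_singleton]
    omega
  have hz := (completedCochain_cocycle hfill hφ (m + 1) {x} (Finset.singleton_nonempty x) hcard).1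
  have hlarge : n ^ Fintype.card ι ≤ size n (completedCochain fill φ (m + 1) {x}) := by
    have : n ^ Fintype.card ι = (Fintype.piFinset fun _ : ι => Finset.range n).card := by
      simp [Fintype.card_piFinset]
    rw [this, size]
    refine Finset.card_le_card_of_injOn (fun v => (∅, v)) (fun v hv => ?_)
      (fun v _ w _ h => (Prod.ext_iff.mp h).2)
    simp only [Finset.mem_coe, Finset.mem_filter, mem_cells]
    refine ⟨⟨fun j => by simpa using Fintype.mem_piFinset.mp hv j, by simp⟩, ?_⟩
    rwa [apply_empty_eq_of_cocycle hz]
  refine hlarge.trans ((size_completedCochain_le hfill hφ (m + 1) {x}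
    (Finset.singleton_nonempty x) hcard).trans (Finset.sum_le_sum fun k _ => ?_))
  exact Nat.mul_le_mul_left _ (sum_size_simplexCochain_le hφ n k x)

end Nerve

/-! ### Colorings of the cube -/

section Coloring

variable {d n m : ℕ} {κ : Type*}

/-- The small cube of a grid point. Coordinates beyond the last index are cut off, so that the
coloring extends to the whole grid `Fin d → ℕ`. -/
def gridCube (hn : 0 < n) (w : Fin d → ℕ) : CubeIndex d n := fun j => ⟨min (w j) (n - 1), by omega⟩

/-- All small cubes of the vertices of a unit cube of the grid contain a common point. -/
theorem exists_mem_smallCube_gridCube (hn : 0 < n) (v : Fin d → ℕ) :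
    ∃ x : Fin d → ℝ, ∀ w ∈ Finset.Icc v (topVertex Finset.univ v),
      x ∈ smallCube (gridCube hn w) := by
  refine ⟨fun j => ((min (v j + 1) (n - 1) : ℕ) : ℝ) / n, fun w hw j => ?_⟩
  have h1 : v j ≤ w j := (Finset.mem_Icc.mp hw).1 j
  have h2 : w j ≤ v j + 1 := by simpa [topVertex] using (Finset.mem_Icc.mp hw).2 j
  have h3 : min (w j) (n - 1) ≤ min (v j + 1) (n - 1) := by omega
  have h4 : min (v j + 1) (n - 1) ≤ min (w j) (n - 1) + 1 := by omega
  constructor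
  · exact div_le_div_of_nonneg_right (Nat.cast_le.mpr h3) n.cast_nonneg
  · exact div_le_div_of_nonneg_right (by exact_mod_cast h4) n.cast_nonneg

/-- The monochromatic component of the small cube of a grid point. -/
def gridComponent (hn : 0 < n) (c : CubeIndex d n → κ) (w : Fin d → ℕ) :
    (monoGraph c).ConnectedComponent :=
  (monoGraph c).connectedComponentMk (gridCube hn w)

open Classical in
/-- Small cubes of one color with a common point lie in one component, so a point in small cubes of
at most `m + 1` colors meets at most `m + 1` components. -/
theorem card_image_gridComponent_le (hn : 0 < n) (c : CubeIndex d n → κ)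
    (hc : ∀ x : Fin d → ℝ, (colorsAt c x).encard ≤ ((m + 1 : ℕ) : ℕ∞)) (v : Fin d → ℕ) :
    ((Finset.Icc v (topVertex Finset.univ v)).image (gridComponent hn c)).card ≤ m + 1 := by
  obtain ⟨x, hx⟩ := exists_mem_smallCube_gridCube hn v
  set I := Finset.Icc v (topVertex Finset.univ v)
  have hcolors : (I.image fun w => c (gridCube hn w)).card ≤ m + 1 := by
    have hsub : ((I.image fun w => c (gridCube hn w) : Finset κ) : Set κ) ⊆ colorsAt c x := by
      intro k hk
      obtain ⟨w, hw, rfl⟩ := Finset.mem_image.mp (Finset.mem_coe.mp hk)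
      exact ⟨_, hx w hw, rfl⟩
    have h := (Set.encard_le_encard hsub).trans (hc x)
    rw [Set.encard_coe_eq_coe_finsetCard] at h
    exact_mod_cast h
  refine le_trans (Finset.card_le_card_of_forall_subsingleton
    (fun K k => ∃ w ∈ I, gridComponent hn c w = K ∧ c (gridCube hn w) = k) ?_ ?_) hcolors
  · intro K hK
    obtain ⟨w, hw, rfl⟩ := Finset.mem_image.mp hK
    exact ⟨_, Finset.mem_image_of_mem _ hw, w, hw, rfl, rfl⟩
  · rintro k - K ⟨-, w, hw, rfl, hk⟩ K' ⟨-, w', hw', rfl, hk'⟩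
    by_cases h : gridCube hn w = gridCube hn w'
    · simp only [gridComponent, h]
    · have hadj : (monoGraph c).Adj (gridCube hn w) (gridCube hn w') :=
        ⟨h, hk.trans hk'.symm, x, hx w hw, hx w' hw'⟩
      exact SimpleGraph.ConnectedComponent.sound hadj.reachable

open Classical in
theorem card_filter_gridComponent_le (hn : 0 < n) (c : CubeIndex d n → κ)
    (K : (monoGraph c).ConnectedComponent) :
    ((Fintype.piFinset fun _ : Fin d => Finset.range n).filter
      fun w => gridComponent hn c w = K).card ≤ K.supp.ncard := by
  rw [← Set.ncard_coe_finset]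
  refine Set.ncard_le_ncard_of_injOn (gridCube hn) (fun w hw => ?_) (fun w hw w' hw' h => ?_)
    (Set.toFinite _)
  · exact (Finset.mem_filter.mp (Finset.mem_coe.mp hw)).2
  · funext j
    have h1 := Fintype.mem_piFinset.mp (Finset.mem_filter.mp (Finset.mem_coe.mp hw)).1 j
    have h2 := Fintype.mem_piFinset.mp (Finset.mem_filter.mp (Finset.mem_coe.mp hw')).1 j
    have h3 : min (w j) (n - 1) = min (w' j) (n - 1) := congrArg Fin.val (congrFun h j)
    rw [Finset.mem_range] at h1 h2
    omega

/-- The contribution of the faces of dimension less than `m` to the bound on a component. -/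
def lowerOrderConstant (d m : ℕ) : ℕ :=
  ∑ k ∈ Finset.range m, k.factorial * ((m + 1).choose (k + 1) * (d.choose k * 2 ^ k))

theorem exists_large_component (hmd : m < d) (hn : 1 ≤ n) (c : CubeIndex d n → κ)
    (hc : ∀ x : Fin d → ℝ, (colorsAt c x).encard ≤ ((m + 1 : ℕ) : ℕ∞)) :
    ∃ K : (monoGraph c).ConnectedComponent, ∀ D : ℝ,
      (m.factorial * d.choose m * 2 ^ m : ℝ) + lowerOrderConstant d m / n ≤ D →
        D⁻¹ * (n : ℝ) ^ (d - m) ≤ (K.supp.ncard : ℝ) := by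
  classical
  have : Fintype (monoGraph c).ConnectedComponent := Fintype.ofFinite _
  obtain ⟨K, hK⟩ := exists_large_fiber (m := m) (φ := gridComponent hn c) hn
    (card_image_gridComponent_le hn c hc)
  refine ⟨K, fun D hD => ?_⟩
  rw [Fintype.card_fin] at hK
  set s := K.supp.ncard
  have hn0 : (0 : ℝ) < n := by exact_mod_cast hn
  have hB : (0 : ℝ) < m.factorial * d.choose m * 2 ^ m := by
    have h1 := m.factorial_pos
    have h2 := Nat.choose_pos hmd.le
    positivity
  have hD0 : 0 < D := lt_of_lt_of_le (by positivity) hD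
  have hcount : n ^ d ≤ ∑ k ∈ Finset.range (m + 1), n ^ k * k.factorial *
      ((m + 1).choose (k + 1) * (d.choose k * 2 ^ k * s)) :=
    hK.trans (Finset.sum_le_sum fun k _ => Nat.mul_le_mul_left _ (Nat.mul_le_mul_left _
      (Nat.mul_le_mul_left _ (card_filter_gridComponent_le hn c K))))
  have hreal : (n : ℝ) ^ d ≤ ∑ k ∈ Finset.range (m + 1), (n : ℝ) ^ k * k.factorial *
      ((m + 1).choose (k + 1) * (d.choose k * 2 ^ k * s)) := by exact_mod_cast hcount
  have hlow : ∑ k ∈ Finset.range m, (n : ℝ) ^ k * k.factorial *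
      ((m + 1).choose (k + 1) * (d.choose k * 2 ^ k * s)) ≤
      (n : ℝ) ^ m * (lowerOrderConstant d m / n) * s := by
    rw [lowerOrderConstant]
    push_cast
    rw [Finset.sum_div, Finset.mul_sum, Finset.sum_mul]
    refine Finset.sum_le_sum fun k hk => ?_
    have hpow : (n : ℝ) ^ k ≤ n ^ m / n := by
      rw [le_div_iff₀ hn0, ← pow_succ]
      exact pow_le_pow_right₀ (by exact_mod_cast hn) (Finset.mem_range.mp hk)
    calc (n : ℝ) ^ k * k.factorial * ((m + 1).choose (k + 1) * (d.choose k * 2 ^ k * s))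
        = (n : ℝ) ^ k * (k.factorial * ((m + 1).choose (k + 1) * (d.choose k * 2 ^ k)) * s) := by
          ring
      _ ≤ (n : ℝ) ^ m / n *
          (k.factorial * ((m + 1).choose (k + 1) * (d.choose k * 2 ^ k)) * s) :=
          mul_le_mul_of_nonneg_right hpow (by positivity)
      _ = _ := by ring
  have hfinal : (n : ℝ) ^ m * (n : ℝ) ^ (d - m) ≤ n ^ m * (D * s) := by
    rw [← pow_add, Nat.add_sub_cancel' hmd.le]
    rw [Finset.sum_range_succ, Nat.choose_self, Nat.cast_one] at hreal
    calc (n : ℝ) ^ d ≤ n ^ m * (lowerOrderConstant d m / n) * s +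
          n ^ m * m.factorial * (1 * (d.choose m * 2 ^ m * s)) :=
          hreal.trans (add_le_add_left hlow _)
      _ = n ^ m * (((m.factorial * d.choose m * 2 ^ m : ℝ) + lowerOrderConstant d m / n) * s) := by
          ring
      _ ≤ n ^ m * (D * s) := by gcongr
  rw [inv_mul_le_iff₀ hD0]
  exact le_of_mul_le_mul_left hfinal (by positivity)

end Coloring

/-! ### Comparison of constants -/

theorem factorial_mul_choose_mul_two_pow_le (d : ℕ) {m : ℕ} (hm : 1 ≤ m) :
    (m.factorial * d.choose m * 2 ^ m : ℝ) ≤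
      (m + 1).factorial * d.choose m * 2 ^ (2 * m - 1) := by
  have h1 : (m.factorial : ℝ) ≤ (m + 1).factorial := by
    exact_mod_cast Nat.factorial_le (Nat.le_succ m)
  have h2 : (2 : ℝ) ^ m ≤ 2 ^ (2 * m - 1) := pow_le_pow_right₀ (by norm_num) (by omega)
  gcongr

theorem theorem1 (d m : ℕ) (hmd : m < d) :
    (∃ f : ℝ, 0 < f ∧ ∀ n : ℕ, 1 ≤ n → ∀ (κ : Type) (c : CubeIndex d n → κ),
      (∀ x : Fin d → ℝ, (colorsAt c x).encard ≤ ((m + 1 : ℕ) : ℕ∞)) →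
      ∃ K : (monoGraph c).ConnectedComponent,
        f * (n : ℝ) ^ (d - m) ≤ (K.supp.ncard : ℝ)) ∧
    (1 ≤ m → ∃ A : ℝ, 0 ≤ A ∧ ∀ n : ℕ, 1 ≤ n → ∀ (κ : Type) (c : CubeIndex d n → κ),
      (∀ x : Fin d → ℝ, (colorsAt c x).encard ≤ ((m + 1 : ℕ) : ℕ∞)) →
      ∃ K : (monoGraph c).ConnectedComponent,
        ((Nat.factorial (m + 1) : ℝ) * (Nat.choose d m : ℝ) * 2 ^ (2 * m - 1) + A / n)⁻¹
          * (n : ℝ) ^ (d - m) ≤ (K.supp.ncard : ℝ)) ∧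
    (∃ N : ℕ, 1 ≤ N ∧ ∀ n : ℕ, N ≤ n → ∀ (κ : Type) (c : CubeIndex d n → κ),
      (∀ x : Fin d → ℝ, (colorsAt c x).encard ≤ ((m + 1 : ℕ) : ℕ∞)) →
      ∃ K : (monoGraph c).ConnectedComponent,
        ((Nat.factorial (m + 1) : ℝ) * (Nat.choose d m : ℝ) * 4 ^ m)⁻¹
          * (n : ℝ) ^ (d - m) ≤ (K.supp.ncard : ℝ)) := by
  have hchoose : (1 : ℝ) ≤ d.choose m := by exact_mod_cast Nat.choose_pos hmd.le
  refine ⟨?_, fun hm => ?_, ?_⟩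
  · have hfact : (0 : ℝ) < m.factorial := by exact_mod_cast m.factorial_pos
    refine ⟨((m.factorial * d.choose m * 2 ^ m : ℝ) + lowerOrderConstant d m)⁻¹, by positivity,
      fun n hn κ c hc => ?_⟩
    obtain ⟨K, hK⟩ := exists_large_component hmd hn c hc
    exact ⟨K, hK _ (by
      gcongr
      exact div_le_self (Nat.cast_nonneg _) (by exact_mod_cast hn))⟩
  · refine ⟨lowerOrderConstant d m, Nat.cast_nonneg _, fun n hn κ c hc => ?_⟩
    obtain ⟨K, hK⟩ := exists_large_component hmd hn c hc
    exact ⟨K, hK _ (by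
      gcongr ?_ + _
      exact factorial_mul_choose_mul_two_pow_le d hm)⟩
  · refine ⟨lowerOrderConstant d m + 1, Nat.le_add_left _ _, fun n hn κ c hc => ?_⟩
    obtain ⟨K, hK⟩ := exists_large_component hmd (le_trans (Nat.le_add_left _ _) hn) c hc
    refine ⟨K, hK _ ?_⟩
    rcases Nat.eq_zero_or_pos m with rfl | hm
    · simp [lowerOrderConstant]
    · have hn0 : (0 : ℝ) < n := by
        have : 0 < n := by omega
        exact_mod_cast this
      have hA : (lowerOrderConstant d m : ℝ) / n ≤ 1 := by
        rw [div_le_one hn0]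
        exact_mod_cast (Nat.le_succ _).trans hn
      -- For `m ≥ 1` the constant is twice the one with `2 ^ (2 * m - 1)`; the excess absorbs
      -- the lower order term.
      have hdouble : (4 : ℝ) ^ m = 2 ^ (2 * m - 1) + 2 ^ (2 * m - 1) := by
        rw [← two_mul, ← pow_succ', show 2 * m - 1 + 1 = 2 * m by omega, pow_mul]
        norm_num
      have hone : (1 : ℝ) ≤ (m + 1).factorial * d.choose m * 2 ^ (2 * m - 1) := by
        have h1 : (1 : ℝ) ≤ (m + 1).factorial := by exact_mod_cast (m + 1).factorial_pos
        exact one_le_mul_of_one_le_of_one_le (one_le_mul_of_one_le_of_one_le h1 hchoose)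
          (one_le_pow₀ (by norm_num))
      rw [hdouble, mul_add]
      exact add_le_add (factorial_mul_choose_mul_two_pow_le d hm) (hA.trans hone)
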